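/- Let $\rho\ge 1$ be an integer and $p>0$ a real number. Let $E_{\rho,p}$ be the complex vector space of all entire functions $f:\mathbb{C}\to\mathbb{C}$ satisfying $$\lim_{R\to\infty}\ \sup_{|z|\ge R}\frac{\ln|f(z)|}{|z|^\rho}\le p\qquad(\ln 0=-\infty),$$ endowed with the topology generated by the norms $$\|f\|_n=\sup_{z\in\mathbb{C}}\exp\big[-(p+1/n)|z|^\rho\big]\,|f(z)|,\qquad n=1,2,3,\dots$$ Let $\mathcal{S}\subset E_{\rho,p}$ be the set of all functions in $E_{\rho,p}$ that are surjective as maps $\mathbb{C}\to\mathbb{C}$. Then: 1. $\mathcal{S}$ is a $G_\delta$ set in $E_{\rho,p}$ and it is dense in $E_{\rho,p}$. 2. The non-surjective functions in $E_{\rho,p}$ are exactly the functions of the form $$f(z)=b\exp\Big(\sum_{k=1}^{\rho}\alpha_k z^k\Big)+a,\qquad a,b,\alpha_1,\dots,\alpha_\rho\in\mathbb{C},\quad |\alpha_\rho|\le p,$$ and the set $E_{\rho,p}\setminus\mathcal{S}$ is a countable union of compact subsets of $E_{\rho,p}$. -/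

import Mathlib

open Filter Set Function

noncomputable section

namespace EntireGrowth

/-- The quantity `limsup_{|z| → ∞} ln |f z| / |z| ^ ρ`, that is
`lim_{R → ∞} sup_{|z| ≥ R} ln |f z| / |z| ^ ρ`, as an extended real number (with `ln 0 = -∞`). -/
def growth (ρ : ℕ) (f : ℂ → ℂ) : EReal :=
  limsup (fun z : ℂ => ENNReal.log ‖f z‖ₑ / ((‖z‖ ^ ρ : ℝ) : EReal)) (Bornology.cobounded ℂ)

theorem log_div_le_iff (ρ : ℕ) (f : ℂ → ℂ) (c : ℝ) {z : ℂ} (hz : z ≠ 0) :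
    ENNReal.log ‖f z‖ₑ / ((‖z‖ ^ ρ : ℝ) : EReal) ≤ (c : EReal) ↔
      ‖f z‖ ≤ Real.exp (c * ‖z‖ ^ ρ) := by
  have hpos : 0 < ‖z‖ ^ ρ := pow_pos (norm_pos_iff.2 hz) ρ
  rw [EReal.div_le_iff_le_mul (by exact_mod_cast hpos) (EReal.coe_ne_top _), mul_comm,
    ← EReal.coe_mul]
  have h : ((c * ‖z‖ ^ ρ : ℝ) : EReal)
      = ENNReal.log (ENNReal.ofReal (Real.exp (c * ‖z‖ ^ ρ))) := by
    rw [ENNReal.log_ofReal_of_pos (Real.exp_pos _), Real.log_exp]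
  rw [h, ENNReal.log_le_log_iff, ← ofReal_norm,
    ENNReal.ofReal_le_ofReal_iff (Real.exp_pos _).le]

theorem growth_le_iff (ρ : ℕ) (p : ℝ) (f : ℂ → ℂ) :
    growth ρ f ≤ (p : EReal) ↔ ∀ ε : ℝ, 0 < ε →
      ∀ᶠ z in Bornology.cobounded ℂ, ‖f z‖ ≤ Real.exp ((p + ε) * ‖z‖ ^ ρ) := by
  have h0 : ∀ᶠ z : ℂ in Bornology.cobounded ℂ, z ≠ 0 :=
    Bornology.eventually_ne_cobounded 0
  rw [growth, limsup_le_iff']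
  constructor
  · intro h ε hε
    have hlt : (p : EReal) < ((p + ε : ℝ) : EReal) := by
      exact_mod_cast lt_add_of_pos_right p hε
    filter_upwards [h _ hlt, h0] with z hz hz0
    exact (log_div_le_iff ρ f _ hz0).1 hz
  · intro h y hy
    obtain ⟨c, hpc, hcy⟩ := EReal.lt_iff_exists_real_btwn.1 hy
    have hpc' : p < c := by exact_mod_cast hpc
    filter_upwards [h (c - p) (sub_pos.2 hpc'), h0] with z hz hz0
    refine le_trans ((log_div_le_iff ρ f c hz0).2 ?_) hcy.le
    simpa using hz

theorem eventually_mul_exp_le (ρ : ℕ) [NeZero ρ] (K c d : ℝ) (hcd : c < d) :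
    ∀ᶠ z : ℂ in Bornology.cobounded ℂ,
      K * Real.exp (c * ‖z‖ ^ ρ) ≤ Real.exp (d * ‖z‖ ^ ρ) := by
  have h1 : Tendsto (fun z : ℂ => Real.exp ((d - c) * ‖z‖ ^ ρ)) (Bornology.cobounded ℂ) atTop :=
    Real.tendsto_exp_atTop.comp (Tendsto.const_mul_atTop (sub_pos.2 hcd)
      ((tendsto_pow_atTop (NeZero.ne ρ)).comp tendsto_norm_cobounded_atTop))
  filter_upwards [h1.eventually_ge_atTop K] with z hz
  calc K * Real.exp (c * ‖z‖ ^ ρ)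
      ≤ Real.exp ((d - c) * ‖z‖ ^ ρ) * Real.exp (c * ‖z‖ ^ ρ) := by gcongr
    _ = Real.exp (d * ‖z‖ ^ ρ) := by rw [← Real.exp_add]; ring_nf

/-- The complex vector space of entire functions `f` with
`lim_{R → ∞} sup_{|z| ≥ R} ln |f z| / |z| ^ ρ ≤ p`. -/
def entireSubmodule (ρ : ℕ) [NeZero ρ] (p : ℝ) : Submodule ℂ (ℂ → ℂ) where
  carrier := {f | Differentiable ℂ f ∧ growth ρ f ≤ (p : EReal)}
  zero_mem' := by
    refine ⟨differentiable_const 0, (growth_le_iff ρ p _).2 fun ε _ => ?_⟩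
    exact Eventually.of_forall fun z => by simpa using (Real.exp_pos _).le
  add_mem' := by
    rintro f g ⟨hf, hf'⟩ ⟨hg, hg'⟩
    refine ⟨hf.add hg, (growth_le_iff ρ p _).2 fun ε hε => ?_⟩
    filter_upwards [(growth_le_iff ρ p f).1 hf' (ε / 2) (half_pos hε),
      (growth_le_iff ρ p g).1 hg' (ε / 2) (half_pos hε),
      eventually_mul_exp_le ρ 2 (p + ε / 2) (p + ε) (by linarith)] with z h1 h2 h3
    calc ‖(f + g) z‖ ≤ ‖f z‖ + ‖g z‖ := norm_add_le _ _
      _ ≤ _ := by linarith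
  smul_mem' := by
    rintro c f ⟨hf, hf'⟩
    refine ⟨hf.const_smul c, (growth_le_iff ρ p _).2 fun ε hε => ?_⟩
    filter_upwards [(growth_le_iff ρ p f).1 hf' (ε / 2) (half_pos hε),
      eventually_mul_exp_le ρ ‖c‖ (p + ε / 2) (p + ε) (by linarith)] with z h1 h3
    calc ‖(c • f) z‖ = ‖c‖ * ‖f z‖ := by simp
      _ ≤ ‖c‖ * Real.exp ((p + ε / 2) * ‖z‖ ^ ρ) := by gcongr
      _ ≤ _ := h3

/-- The space `E_{ρ,p}`. It is a separate type, so that it carries the topology of the weighted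
norms and not that of pointwise convergence. -/
def E (ρ : ℕ) [NeZero ρ] (p : ℝ) : Type := entireSubmodule ρ p

variable {ρ : ℕ} [NeZero ρ] {p : ℝ}

instance : AddCommGroup (E ρ p) := inferInstanceAs (AddCommGroup (entireSubmodule ρ p))

instance : Module ℂ (E ρ p) := inferInstanceAs (Module ℂ (entireSubmodule ρ p))

instance : FunLike (E ρ p) ℂ ℂ where
  coe f := f.1
  coe_injective := fun _ _ h => Subtype.ext h

theorem E.add_apply (f g : E ρ p) (z : ℂ) : (f + g) z = f z + g z := rfl

theorem E.smul_apply (c : ℂ) (f : E ρ p) (z : ℂ) : (c • f) z = c * f z := rfl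

theorem E.zero_apply (z : ℂ) : (0 : E ρ p) z = 0 := rfl

/-- The weight `v_n(r) = exp (-(p + 1/n) r ^ ρ)`, for `n ≥ 1`. -/
def weight (ρ : ℕ) (p : ℝ) (n : ℕ+) (r : ℝ) : ℝ := Real.exp (-(p + 1 / (n : ℝ)) * r ^ ρ)

theorem E.bddAbove (n : ℕ+) (f : E ρ p) :
    BddAbove (range fun z : ℂ => weight ρ p n ‖z‖ * ‖f z‖) := by
  have hn : (0 : ℝ) < 1 / (n : ℝ) := one_div_pos.2 (by exact_mod_cast n.pos)
  have hev := (growth_le_iff ρ p f).1 f.2.2 _ hn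
  obtain ⟨R, -, hR⟩ := (Filter.HasBasis.eventually_iff
    (Metric.hasBasis_cobounded_compl_closedBall (0 : ℂ))).1 hev
  have hcont : Continuous fun z : ℂ => weight ρ p n ‖z‖ * ‖f z‖ := by
    have : Continuous f := f.2.1.continuous
    unfold weight
    fun_prop
  obtain ⟨C, hC⟩ := ((isCompact_closedBall (0 : ℂ) R).image hcont).bddAbove
  refine ⟨max C 1, ?_⟩
  rintro _ ⟨z, rfl⟩
  by_cases hz : z ∈ Metric.closedBall (0 : ℂ) R
  · exact le_max_of_le_left (hC ⟨z, hz, rfl⟩)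
  · refine le_max_of_le_right ?_
    calc weight ρ p n ‖z‖ * ‖f z‖
        ≤ weight ρ p n ‖z‖ * Real.exp ((p + 1 / (n : ℝ)) * ‖z‖ ^ ρ) :=
          mul_le_mul_of_nonneg_left (hR hz) (Real.exp_pos _).le
      _ = 1 := by
          rw [weight, ← Real.exp_add, neg_mul, neg_add_cancel, Real.exp_zero]

/-- The norm `‖f‖_n = sup_z v_n(|z|) |f z|` on `E_{ρ,p}`. -/
def normSeq (ρ : ℕ) [NeZero ρ] (p : ℝ) (n : ℕ+) : Seminorm ℂ (E ρ p) :=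
  Seminorm.of (fun f => ⨆ z : ℂ, weight ρ p n ‖z‖ * ‖f z‖)
    (fun f g => ciSup_le fun z => by
      refine le_trans ?_ (add_le_add (le_ciSup (E.bddAbove n f) z) (le_ciSup (E.bddAbove n g) z))
      rw [← mul_add, E.add_apply]
      exact mul_le_mul_of_nonneg_left (norm_add_le _ _) (Real.exp_pos _).le)
    (fun c f => by
      rw [Real.mul_iSup_of_nonneg (norm_nonneg c)]
      congr 1
      ext z
      rw [E.smul_apply, norm_mul]
      ring)

/-- The topology of `E_{ρ,p}` generated by the sequence of norms `‖·‖_n`, `n ≥ 1`. -/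
instance : TopologicalSpace (E ρ p) :=
  (SeminormFamily.moduleFilterBasis (𝕜 := ℂ) (normSeq ρ p)).topology

theorem E.withSeminorms (ρ : ℕ) [NeZero ρ] (p : ℝ) :
    WithSeminorms (𝕜 := ℂ) (E := E ρ p) (normSeq ρ p) := ⟨rfl⟩

/-- The function `z ↦ b exp (∑_{k=1}^ρ α_k z ^ k) + a`. -/
def expPoly (ρ : ℕ) (α : ℕ → ℂ) (a b : ℂ) (z : ℂ) : ℂ :=
  b * Complex.exp (∑ k ∈ Finset.Icc 1 ρ, α k * z ^ k) + a

end EntireGrowth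

end

/-! If `f` omits the value `a`, then `f - a = exp g` with `g` entire, and the growth condition
bounds the real part of `g` by `(p + ε)|z|^ρ` near infinity. Borel–Carathéodory and Cauchy's
estimates make `g` a polynomial of degree at most `ρ` (`eq_sum_of_re_le`); a ray on which the
leading term is real and nonnegative gives `|α_ρ| ≤ p` (`norm_coeff_le`). Together they yield
`exists_eq_expPoly`.

The parameters `(α, a, b)` bounded by `M` form a compact set that maps continuously into `E ρ p`
(`continuous_expPolyMap`). Letting `M` run over the naturals exhausts the non-surjective functions,
which are therefore σ-compact; compact sets are closed in this Hausdorff space, so the complement is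
a Gδ.

For density no Baire argument is needed. A nonconstant `a + b exp P` is perturbed to `a + b (exp P +
ε P)`, the composite of the surjections `P` and `w ↦ exp w + ε w` with an affine bijection. The
second map is surjective by the classification itself, applied with `ρ = p = 1`. Constants are
perturbed by `ε z`. -/

namespace EntireGrowth

open Topology

/-! ### Growth of the functions `b exp P + a` -/

/-- Terms of degree less than `ρ` are negligible against `|z| ^ ρ`, uniformly for bounded
coefficients. -/
theorem eventually_norm_sum_le (ρ : ℕ) {s : Finset ℕ} (hs : s ⊆ Finset.range ρ) (M δ : ℝ)
    (hδ : 0 < δ) :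
    ∀ᶠ z : ℂ in Bornology.cobounded ℂ, ∀ c : ℕ → ℂ, (∀ k, ‖c k‖ ≤ M) →
      ‖∑ k ∈ s, c k * z ^ k‖ ≤ δ * ‖z‖ ^ ρ := by
  filter_upwards [tendsto_norm_cobounded_atTop.eventually_ge_atTop 1,
    tendsto_norm_cobounded_atTop.eventually_ge_atTop (s.card * M / δ)] with z h1 h2 c hc
  have hM : 0 ≤ M := (norm_nonneg _).trans (hc 0)
  have h0 : 0 < ‖z‖ := by linarith
  have hterm : ∀ k ∈ s, ‖c k * z ^ k‖ ≤ M * (‖z‖ ^ ρ / ‖z‖) := by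
    intro k hk
    rw [norm_mul, norm_pow]
    refine mul_le_mul (hc k) ?_ (by positivity) hM
    rw [le_div_iff₀ h0, ← pow_succ]
    exact pow_le_pow_right₀ h1 (Finset.mem_range.1 (hs hk))
  calc ‖∑ k ∈ s, c k * z ^ k‖ ≤ s.card • (M * (‖z‖ ^ ρ / ‖z‖)) :=
        (norm_sum_le _ _).trans (Finset.sum_le_card_nsmul _ _ _ hterm)
    _ = s.card * M / ‖z‖ * ‖z‖ ^ ρ := by rw [nsmul_eq_mul]; ring
    _ ≤ δ * ‖z‖ ^ ρ := by
        gcongr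
        rw [div_le_iff₀ h0]
        rwa [div_le_iff₀ hδ, mul_comm ‖z‖] at h2

/-- The functions `b exp (∑ α_k z ^ k) + a` with `|α_ρ| ≤ p` satisfy the growth condition
uniformly for bounded parameters. -/
theorem eventually_norm_expPoly_le (ρ : ℕ) [NeZero ρ] {p : ℝ} (hp : 0 ≤ p) (M ε : ℝ)
    (hε : 0 < ε) :
    ∀ᶠ z : ℂ in Bornology.cobounded ℂ, ∀ (α : ℕ → ℂ) (a b : ℂ), (∀ k, ‖α k‖ ≤ M) →
      ‖a‖ ≤ M → ‖b‖ ≤ M → ‖α ρ‖ ≤ p →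
      ‖expPoly ρ α a b z‖ ≤ Real.exp ((p + ε) * ‖z‖ ^ ρ) := by
  have hs : Finset.Ico 1 ρ ⊆ Finset.range ρ := fun k hk =>
    Finset.mem_range.2 (Finset.mem_Ico.1 hk).2
  filter_upwards [eventually_norm_sum_le ρ hs M (ε / 2) (half_pos hε),
    eventually_mul_exp_le ρ (2 * M) (p + ε / 2) (p + ε) (by linarith)]
    with z h1 h2 α a b hα ha hb hαρ
  have hM : 0 ≤ M := (norm_nonneg _).trans ha
  have hρ : 1 ≤ ρ := NeZero.one_le
  have hsum : ‖∑ k ∈ Finset.Icc 1 ρ, α k * z ^ k‖ ≤ (p + ε / 2) * ‖z‖ ^ ρ := by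
    rw [← Finset.Ico_insert_right hρ, Finset.sum_insert (by simp)]
    refine (norm_add_le _ _).trans ?_
    rw [norm_mul, norm_pow, add_mul]
    exact add_le_add (by gcongr) (h1 α hα)
  have hexp : ‖Complex.exp (∑ k ∈ Finset.Icc 1 ρ, α k * z ^ k)‖ ≤
      Real.exp ((p + ε / 2) * ‖z‖ ^ ρ) :=
    (Complex.norm_exp_le_exp_norm _).trans (Real.exp_le_exp.2 hsum)
  have hone : 1 ≤ Real.exp ((p + ε / 2) * ‖z‖ ^ ρ) := Real.one_le_exp (by positivity)
  calc ‖expPoly ρ α a b z‖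
      ≤ ‖b‖ * ‖Complex.exp (∑ k ∈ Finset.Icc 1 ρ, α k * z ^ k)‖ + ‖a‖ := by
        rw [← norm_mul]; exact norm_add_le _ _
    _ ≤ M * Real.exp ((p + ε / 2) * ‖z‖ ^ ρ) + M * Real.exp ((p + ε / 2) * ‖z‖ ^ ρ) := by
        refine add_le_add (mul_le_mul hb hexp (norm_nonneg _) hM) ?_
        exact ha.trans (le_mul_of_one_le_right hM hone)
    _ = 2 * M * Real.exp ((p + ε / 2) * ‖z‖ ^ ρ) := by ring
    _ ≤ _ := h2

theorem expPoly_congr {ρ : ℕ} {α β : ℕ → ℂ} (h : ∀ k ∈ Finset.Icc 1 ρ, α k = β k) (a b : ℂ) :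
    expPoly ρ α a b = expPoly ρ β a b := by
  funext z
  simp only [expPoly]
  rw [Finset.sum_congr rfl fun k hk => by rw [h k hk]]

/-- The parameters of `expPoly` may be taken bounded. -/
theorem exists_bounded_expPoly (ρ : ℕ) (α : ℕ → ℂ) (a b : ℂ) :
    ∃ (M : ℕ) (β : ℕ → ℂ), (∀ k, ‖β k‖ ≤ M) ∧ ‖a‖ ≤ M ∧ ‖b‖ ≤ M ∧
      (∀ k ∈ Finset.Icc 1 ρ, β k = α k) := by
  obtain ⟨M, hM⟩ := exists_nat_ge (∑ k ∈ Finset.Icc 1 ρ, ‖α k‖ + ‖a‖ + ‖b‖)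
  have h0 : 0 ≤ ∑ k ∈ Finset.Icc 1 ρ, ‖α k‖ := Finset.sum_nonneg fun _ _ => norm_nonneg _
  -- Coefficients outside `1..ρ` never enter `expPoly` and may be unbounded, so they are set to
  -- zero.
  refine ⟨M, fun k => if k ∈ Finset.Icc 1 ρ then α k else 0, fun k => ?_, ?_, ?_,
    fun k hk => if_pos hk⟩
  · dsimp only
    split_ifs with hk
    · have := Finset.single_le_sum (f := fun k => ‖α k‖) (fun _ _ => norm_nonneg _) hk
      linarith [norm_nonneg a, norm_nonneg b]
    · simp
  · linarith [norm_nonneg b]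
  · linarith [norm_nonneg a]

theorem differentiable_expPoly (ρ : ℕ) (α : ℕ → ℂ) (a b : ℂ) :
    Differentiable ℂ (expPoly ρ α a b) := by
  unfold expPoly
  fun_prop

theorem expPoly_mem (ρ : ℕ) [NeZero ρ] {p : ℝ} (hp : 0 ≤ p) {α : ℕ → ℂ} (a b : ℂ)
    (hα : ‖α ρ‖ ≤ p) : expPoly ρ α a b ∈ entireSubmodule ρ p := by
  refine ⟨differentiable_expPoly ρ α a b, (growth_le_iff ρ p _).2 fun ε hε => ?_⟩
  obtain ⟨M, β, hβ, ha, hb, hβα⟩ := exists_bounded_expPoly ρ α a b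
  filter_upwards [eventually_norm_expPoly_le ρ hp M ε hε] with z hz
  rw [← expPoly_congr hβα]
  refine hz β a b hβ ha hb ?_
  rwa [hβα ρ (Finset.mem_Icc.2 ⟨NeZero.one_le, le_rfl⟩)]

theorem not_surjective_expPoly (ρ : ℕ) (α : ℕ → ℂ) (a b : ℂ) :
    ¬ Surjective (expPoly ρ α a b) := by
  intro h
  by_cases hb : b = 0
  · obtain ⟨z, hz⟩ := h (a + 1)
    simp [expPoly, hb] at hz
  · obtain ⟨z, hz⟩ := h a
    simp [expPoly, hb, Complex.exp_ne_zero] at hz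

/-! ### Classification of the entire functions that omit a value -/

/-- An entire function without zeros is the exponential of an entire function. -/
theorem exists_eq_exp_of_forall_ne_zero {F : ℂ → ℂ} (hF : Differentiable ℂ F)
    (h0 : ∀ z, F z ≠ 0) : ∃ g : ℂ → ℂ, Differentiable ℂ g ∧ ∀ z, F z = Complex.exp (g z) := by
  -- The logarithmic derivative is entire, so it has a primitive `G`, and `F exp (-G)` is constant.
  have hd : Differentiable ℂ fun z => deriv F z / F z :=
    (hF.contDiff.differentiable_deriv_two).div hF h0
  obtain ⟨G, hG⟩ := hd.isExactOn_univ
  have hG' : ∀ z, HasDerivAt G (deriv F z / F z) z := fun z => hG z (mem_univ z)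
  have hder : ∀ z, HasDerivAt (fun z => F z * Complex.exp (-G z)) 0 z := by
    intro z
    refine ((hF z).hasDerivAt.mul (hG' z).neg.cexp).congr_deriv ?_
    have := h0 z
    field_simp
    ring
  have hconst : ∀ z, F z * Complex.exp (-G z) = F 0 * Complex.exp (-G 0) := fun z =>
    is_const_of_deriv_eq_zero (fun z => (hder z).differentiableAt) (fun z => (hder z).deriv) z 0
  have hne : F 0 * Complex.exp (-G 0) ≠ 0 := mul_ne_zero (h0 0) (Complex.exp_ne_zero _)
  refine ⟨fun z => Complex.log (F 0 * Complex.exp (-G 0)) + G z,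
    (differentiable_const _).add fun z => (hG' z).differentiableAt, fun z => ?_⟩
  rw [Complex.exp_add, Complex.exp_log hne, ← hconst z, mul_assoc, ← Complex.exp_add]
  simp

/-- An entire function whose real part is `O(|z| ^ ρ)` from above is a polynomial of degree at
most `ρ`. -/
theorem eq_sum_of_re_le {g : ℂ → ℂ} (hg : Differentiable ℂ g) (ρ : ℕ) (q : ℝ) (hq : 0 ≤ q)
    (h : ∀ᶠ z in Bornology.cobounded ℂ, (g z).re ≤ q * ‖z‖ ^ ρ) :
    ∃ c : ℕ → ℂ, ∀ z, g z = ∑ k ∈ Finset.range (ρ + 1), c k * z ^ k := by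
  obtain ⟨R, -, hR⟩ := (Filter.HasBasis.eventually_iff
    (Metric.hasBasis_cobounded_compl_closedBall (0 : ℂ))).1 h
  obtain ⟨B, hB⟩ := ((isCompact_closedBall (0 : ℂ) R).image
    (Complex.continuous_re.comp hg.continuous)).bddAbove
  have hre : ∀ z, (g z).re ≤ q * ‖z‖ ^ ρ + |B| := by
    intro z
    by_cases hz : z ∈ Metric.closedBall (0 : ℂ) R
    · have h1 : (g z).re ≤ B := hB ⟨z, hz, rfl⟩
      have : 0 ≤ q * ‖z‖ ^ ρ := by positivity
      linarith [le_abs_self B]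
    · linarith [hR hz, abs_nonneg B]
  obtain ⟨A, hA⟩ : ∃ A : ℝ, ∀ z, 1 ≤ ‖z‖ → ‖g z‖ ≤ A * ‖z‖ ^ ρ := by
    -- Borel–Carathéodory on the disc of radius `2|z|` gives `2 M + 3 ‖g 0‖`; the `+ 1` makes `M`
    -- positive, and `|z| ≥ 1` absorbs the constants into `|z|^ρ`.
    refine ⟨2 * (q * 2 ^ ρ + |B| + 1) + 3 * ‖g 0‖, fun z hz => ?_⟩
    have hz0 : 0 < ‖z‖ := by linarith
    have hbc := Complex.borelCaratheodory (f := g) (R := 2 * ‖z‖) (z := z)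
      (M := q * (2 * ‖z‖) ^ ρ + |B| + 1) (by positivity) hg.differentiableOn
      (fun w hw => by
        have hw' : ‖w‖ ≤ 2 * ‖z‖ := (mem_ball_zero_iff.1 hw).le
        have : q * ‖w‖ ^ ρ ≤ q * (2 * ‖z‖) ^ ρ := by gcongr
        change (g w).re ≤ _
        linarith [hre w]) (by positivity) (mem_ball_zero_iff.2 (by linarith))
    have hsub : 2 * ‖z‖ - ‖z‖ = ‖z‖ := by ring
    have hadd : 2 * ‖z‖ + ‖z‖ = 3 * ‖z‖ := by ring
    rw [hsub, hadd, mul_div_assoc, div_self hz0.ne', ← mul_assoc, mul_div_assoc _ _ ‖z‖,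
      div_self hz0.ne', mul_pow] at hbc
    have hpow : 1 ≤ ‖z‖ ^ ρ := one_le_pow₀ hz
    nlinarith [mul_nonneg (by positivity : 0 ≤ 2 * (|B| + 1) + 3 * ‖g 0‖) (sub_nonneg.2 hpow)]
  -- Cauchy's estimate on the circle of radius `r` is `O(r^ρ / r^k)`, hence `O(1 / r)` for `k > ρ`.
  have hzero : ∀ k, ρ < k → iteratedDeriv k g 0 = 0 := by
    intro k hk
    have hA0 : 0 ≤ A := by
      have := hA 1 (by simp)
      simp only [norm_one, one_pow, mul_one] at this
      exact (norm_nonneg _).trans this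
    have hbound : ∀ᶠ r : ℝ in atTop, ‖iteratedDeriv k g 0‖ ≤ k.factorial * A / r := by
      filter_upwards [eventually_ge_atTop 1] with r hr
      have hr0 : 0 < r := by linarith
      refine (Complex.norm_iteratedDeriv_le_of_forall_mem_sphere_norm_le k hr0 hg.diffContOnCl
        (C := A * r ^ ρ) fun z hz => ?_).trans ?_
      · rw [mem_sphere_zero_iff_norm] at hz
        simpa [hz] using hA z (by rw [hz]; exact hr)
      · rw [div_le_div_iff₀ (by positivity) hr0]
        have : r ^ ρ * r ≤ r ^ k := by
          rw [← pow_succ]; exact pow_le_pow_right₀ hr hk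
        calc k.factorial * (A * r ^ ρ) * r = k.factorial * A * (r ^ ρ * r) := by ring
          _ ≤ k.factorial * A * r ^ k := by gcongr
    have hlim : Tendsto (fun r : ℝ => k.factorial * A / r) atTop (𝓝 0) :=
      tendsto_const_nhds.div_atTop tendsto_id
    exact norm_le_zero_iff.1 (ge_of_tendsto hlim hbound)
  refine ⟨fun k => (k.factorial : ℂ)⁻¹ * iteratedDeriv k g 0, fun z => ?_⟩
  rw [← Complex.taylorSeries_eq_of_entire' 0 z hg, tsum_eq_sum (s := Finset.range (ρ + 1))]
  · simp
  · intro k hk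
    rw [hzero k (by simpa using hk)]
    simp

/-- If the real part of a polynomial of degree at most `ρ` is at most `(p + ε) |z| ^ ρ` near
infinity for all `ε > 0`, then its coefficient of degree `ρ` has modulus at most `p`. -/
theorem norm_coeff_le {ρ : ℕ} (hρ : ρ ≠ 0) {p : ℝ} (c : ℕ → ℂ)
    (h : ∀ ε : ℝ, 0 < ε → ∀ᶠ z in Bornology.cobounded ℂ,
      (∑ k ∈ Finset.range (ρ + 1), c k * z ^ k).re ≤ (p + ε) * ‖z‖ ^ ρ) : ‖c ρ‖ ≤ p := by
  -- Along the ray through `u` the leading term equals its modulus, so bounding the real part bounds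
  -- `‖c ρ‖`.
  obtain ⟨u, hu1, hu⟩ : ∃ u : ℂ, ‖u‖ = 1 ∧ c ρ * u ^ ρ = ‖c ρ‖ := by
    by_cases hc : c ρ = 0
    · exact ⟨1, by simp, by simp [hc]⟩
    · obtain ⟨u, hu⟩ := IsAlgClosed.exists_pow_nat_eq ((‖c ρ‖ : ℂ) / c ρ) (Nat.pos_of_ne_zero hρ)
      refine ⟨u, ?_, by rw [hu]; field_simp⟩
      have : ‖u‖ ^ ρ = 1 := by
        rw [← norm_pow, hu, norm_div]
        simp [hc]
      exact (pow_eq_one_iff_of_nonneg (norm_nonneg _) hρ).1 this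
  have hlim : Tendsto (fun r : ℝ => (r : ℂ) * u) atTop (Bornology.cobounded ℂ) := by
    rw [← tendsto_norm_atTop_iff_cobounded]
    simpa [hu1] using tendsto_abs_atTop_atTop
  obtain ⟨M, hM⟩ : ∃ M : ℝ, ∀ k ∈ Finset.range ρ, ‖c k‖ ≤ M :=
    ⟨∑ k ∈ Finset.range ρ, ‖c k‖, fun k hk =>
      Finset.single_le_sum (f := fun k => ‖c k‖) (fun _ _ => norm_nonneg _) hk⟩
  let c' : ℕ → ℂ := fun k => if k ∈ Finset.range ρ then c k else 0
  have hc' : ∀ k, ‖c' k‖ ≤ |M| := by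
    intro k
    simp only [c']
    split_ifs with hk
    · exact (hM k hk).trans (le_abs_self M)
    · simp
  refine le_of_forall_pos_le_add fun ε hε => ?_
  obtain ⟨r, h1, h2, h3⟩ := ((hlim.eventually (h (ε / 2) (half_pos hε))).and
    ((hlim.eventually (eventually_norm_sum_le ρ subset_rfl |M| (ε / 2) (half_pos hε))).and
      (eventually_gt_atTop 0))).exists
  have hr : ‖(r : ℂ) * u‖ = r := by simp [hu1, abs_of_pos h3]
  specialize h2 c' hc'
  have hcc : ∑ k ∈ Finset.range ρ, c' k * (r * u) ^ k = ∑ k ∈ Finset.range ρ, c k * (r * u) ^ k :=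
    Finset.sum_congr rfl fun k hk => by simp only [c', if_pos hk]
  rw [hcc, hr] at h2
  have htop : c ρ * ((r : ℂ) * u) ^ ρ = ((‖c ρ‖ * r ^ ρ : ℝ) : ℂ) := by
    rw [mul_pow, mul_left_comm, hu]; push_cast; ring
  rw [Finset.sum_range_succ, htop, Complex.add_re, Complex.ofReal_re, hr] at h1
  have h4 := neg_le_of_abs_le ((Complex.abs_re_le_norm _).trans h2)
  have hpos : 0 < r ^ ρ := pow_pos h3 ρ
  refine le_of_mul_le_mul_right ?_ hpos
  linarith

/-- The non-surjective functions of `E_{ρ,p}` have the form `b exp (∑ α_k z ^ k) + a`. -/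
theorem exists_eq_expPoly {ρ : ℕ} [NeZero ρ] {p : ℝ} (hp : 0 ≤ p) {f : ℂ → ℂ}
    (hf : f ∈ entireSubmodule ρ p) (hs : ¬ Surjective f) :
    ∃ (α : ℕ → ℂ) (a b : ℂ), ‖α ρ‖ ≤ p ∧ f = expPoly ρ α a b := by
  obtain ⟨a, ha⟩ : ∃ a, ∀ z, f z ≠ a := by simpa [Surjective] using hs
  -- Constants lie in the space, so `f - a` inherits the growth bound by linearity.
  have hconst : (fun _ : ℂ => a) ∈ entireSubmodule ρ p := by
    have := expPoly_mem ρ hp (α := 0) a 0 (by simpa using hp)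
    rwa [show expPoly ρ 0 a 0 = fun _ => a by funext z; simp [expPoly]] at this
  have hF := (entireSubmodule ρ p).sub_mem hf hconst
  obtain ⟨g, hg, hgF⟩ := exists_eq_exp_of_forall_ne_zero hF.1 fun z => sub_ne_zero.2 (ha z)
  have hre : ∀ ε : ℝ, 0 < ε →
      ∀ᶠ z in Bornology.cobounded ℂ, (g z).re ≤ (p + ε) * ‖z‖ ^ ρ := by
    intro ε hε
    filter_upwards [(growth_le_iff ρ p _).1 hF.2 ε hε] with z hz
    rwa [hgF z, Complex.norm_exp, Real.exp_le_exp] at hz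
  obtain ⟨c, hc⟩ := eq_sum_of_re_le hg ρ (p + 1) (by linarith) (hre 1 one_pos)
  -- The constant term of the exponent becomes the factor `b`.
  refine ⟨c, a, Complex.exp (c 0), norm_coeff_le (NeZero.ne ρ) c fun ε hε => ?_, ?_⟩
  · simpa only [← hc] using hre ε hε
  · funext z
    have h1 : f z = Complex.exp (g z) + a := by
      rw [← hgF z]; simp
    rw [h1, hc z, expPoly, ← Complex.exp_add, Finset.range_eq_Ico,
      Finset.sum_eq_sum_Ico_succ_bot (Nat.succ_pos ρ)]
    simp only [pow_zero, mul_one, zero_add]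
    rfl

/-! ### The topology of `E ρ p` and continuity of parametrised families -/

variable {ρ : ℕ} [NeZero ρ] {p : ℝ}

/-- The element of `E_{ρ,p}` given by a function of the required growth. -/
def E.mk (f : ℂ → ℂ) (hf : f ∈ entireSubmodule ρ p) : E ρ p := ⟨f, hf⟩

theorem E.mk_apply {f : ℂ → ℂ} (hf : f ∈ entireSubmodule ρ p) (z : ℂ) : E.mk f hf z = f z := rfl

theorem E.sub_apply (f g : E ρ p) (z : ℂ) : (f - g) z = f z - g z := rfl

theorem weight_mul_norm_le_normSeq (n : ℕ+) (f : E ρ p) (z : ℂ) :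
    weight ρ p n ‖z‖ * ‖f z‖ ≤ normSeq ρ p n f :=
  le_ciSup (E.bddAbove n f) z

theorem normSeq_le {n : ℕ+} {f : E ρ p} {C : ℝ} (h : ∀ z, weight ρ p n ‖z‖ * ‖f z‖ ≤ C) :
    normSeq ρ p n f ≤ C :=
  ciSup_le h

instance : IsTopologicalAddGroup (E ρ p) := (E.withSeminorms ρ p).topologicalAddGroup

instance : ContinuousSMul ℂ (E ρ p) := (E.withSeminorms ρ p).continuousSMul

instance : T2Space (E ρ p) := by
  have : T1Space (E ρ p) := (E.withSeminorms ρ p).T1_of_separating fun f hf => by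
    by_contra! h
    refine hf (DFunLike.ext _ _ fun z => ?_)
    have h1 := weight_mul_norm_le_normSeq 1 f z
    rw [h 1] at h1
    have h2 : ‖f z‖ ≤ 0 := nonpos_of_mul_nonpos_right h1 (Real.exp_pos _)
    rw [E.zero_apply]
    exact norm_le_zero_iff.1 h2
  infer_instance

/-- A family of functions in `E_{ρ,p}`, depending continuously on a parameter and growing
uniformly in it, is continuous as a map into `E_{ρ,p}`. -/
theorem continuous_of_uniform_growth {X : Type*} [TopologicalSpace X] (hp : 0 ≤ p)
    (F : X → E ρ p) (hF : Continuous fun y : X × ℂ => F y.1 y.2)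
    (hg : ∀ ε : ℝ, 0 < ε → ∀ᶠ z in Bornology.cobounded ℂ, ∀ x,
      ‖F x z‖ ≤ Real.exp ((p + ε) * ‖z‖ ^ ρ)) : Continuous F := by
  rw [continuous_iff_continuousAt]
  intro x₀
  rw [ContinuousAt, (E.withSeminorms ρ p).tendsto_nhds]
  intro n η hη
  have hn : (0 : ℝ) < 1 / (n : ℝ) := one_div_pos.2 (by exact_mod_cast n.pos)
  -- Half of the margin `1 / n` is spent on the growth of the family; the other half makes the
  -- weighted difference at most `η / 2` off a disc, whatever the parameter.
  have hev := (hg (1 / n / 2) (half_pos hn)).and (eventually_mul_exp_le ρ (4 / η)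
    (p + 1 / n / 2) (p + 1 / n) (by linarith))
  obtain ⟨R, -, hR⟩ := (Filter.HasBasis.eventually_iff
    (Metric.hasBasis_cobounded_compl_closedBall (0 : ℂ))).1 hev
  -- On the disc, compactness turns joint continuity into uniform closeness.
  have hcpt : ∀ᶠ x in 𝓝 x₀, ∀ z ∈ Metric.closedBall (0 : ℂ) R, ‖F x z - F x₀ z‖ < η / 2 := by
    refine (isCompact_closedBall (0 : ℂ) R).eventually_forall_of_forall_eventually fun z _ => ?_
    have hc : Continuous fun y : X × ℂ => ‖F y.1 y.2 - F x₀ y.2‖ := by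
      have h0 : Continuous (F x₀) := (F x₀).2.1.continuous
      fun_prop
    have := hc.tendsto (x₀, z)
    simp only [sub_self, norm_zero] at this
    exact this.eventually_lt_const (half_pos hη)
  filter_upwards [hcpt] with x hx
  refine lt_of_le_of_lt (normSeq_le (C := η / 2) fun z => ?_) (half_lt_self hη)
  rw [E.sub_apply]
  by_cases hz : z ∈ Metric.closedBall (0 : ℂ) R
  · have hw : weight ρ p n ‖z‖ ≤ 1 := by
      rw [weight, Real.exp_le_one_iff, neg_mul, neg_nonpos]
      positivity
    exact (mul_le_of_le_one_left (norm_nonneg _) hw).trans (hx z hz).le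
  · obtain ⟨h1, h2⟩ := hR hz
    have h3 : ‖F x z - F x₀ z‖ ≤ 2 * Real.exp ((p + 1 / n / 2) * ‖z‖ ^ ρ) :=
      (norm_sub_le _ _).trans (by linarith [h1 x, h1 x₀])
    have h4 : 2 * Real.exp ((p + 1 / n / 2) * ‖z‖ ^ ρ) ≤
        η / 2 * Real.exp ((p + 1 / n) * ‖z‖ ^ ρ) := by
      have := mul_le_mul_of_nonneg_left h2 (half_pos hη).le
      rwa [← mul_assoc, show η / 2 * (4 / η) = 2 by field_simp; norm_num] at this
    calc weight ρ p n ‖z‖ * ‖F x z - F x₀ z‖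
        ≤ weight ρ p n ‖z‖ * (η / 2 * Real.exp ((p + 1 / n) * ‖z‖ ^ ρ)) :=
          mul_le_mul_of_nonneg_left (h3.trans h4) (Real.exp_pos _).le
      _ = η / 2 := by
          rw [weight, mul_left_comm, ← Real.exp_add, neg_mul, neg_add_cancel, Real.exp_zero,
            mul_one]

/-! ### Compact parameter sets, σ-compactness and the Gδ property -/

/-- The parameters `(α, a, b)` of `expPoly` bounded by `M`, with `|α_ρ| ≤ p`. -/
def boundedParams (ρ : ℕ) (p M : ℝ) : Set ((ℕ → ℂ) × ℂ × ℂ) :=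
  ((univ.pi fun _ => Metric.closedBall 0 M) ×ˢ Metric.closedBall 0 M ×ˢ Metric.closedBall 0 M) ∩
    {x | ‖x.1 ρ‖ ≤ p}

theorem mem_boundedParams {ρ : ℕ} {p M : ℝ} {x : (ℕ → ℂ) × ℂ × ℂ} :
    x ∈ boundedParams ρ p M ↔
      ((∀ k, ‖x.1 k‖ ≤ M) ∧ ‖x.2.1‖ ≤ M ∧ ‖x.2.2‖ ≤ M) ∧ ‖x.1 ρ‖ ≤ p := by
  simp [boundedParams, mem_prod, Set.mem_pi]

/-- Tychonoff's theorem handles the infinite coefficient sequences in the product topology. -/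
theorem isCompact_boundedParams (ρ : ℕ) (p M : ℝ) : IsCompact (boundedParams ρ p M) := by
  refine IsCompact.inter_right ?_ (isClosed_le (by fun_prop) continuous_const)
  exact (isCompact_univ_pi fun _ => isCompact_closedBall _ _).prod
    ((isCompact_closedBall _ _).prod (isCompact_closedBall _ _))

/-- The map `(α, a, b) ↦ b exp (∑ α_k z ^ k) + a` from bounded parameters to `E_{ρ,p}`. -/
noncomputable def expPolyMap (ρ : ℕ) [NeZero ρ] {p : ℝ} (hp : 0 ≤ p) (M : ℝ) (x : boundedParams ρ p M) :
    E ρ p :=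
  E.mk (expPoly ρ x.1.1 x.1.2.1 x.1.2.2) (expPoly_mem ρ hp _ _ (mem_boundedParams.1 x.2).2)

theorem continuous_expPolyMap (hp : 0 ≤ p) (M : ℝ) : Continuous (expPolyMap ρ hp M) := by
  refine continuous_of_uniform_growth hp _ ?_ fun ε hε => ?_
  · change Continuous fun y : boundedParams ρ p M × ℂ =>
      expPoly ρ y.1.1.1 y.1.1.2.1 y.1.1.2.2 y.2
    unfold expPoly
    fun_prop
  · filter_upwards [eventually_norm_expPoly_le ρ hp M ε hε] with z hz x
    obtain ⟨⟨h1, h2, h3⟩, h4⟩ := mem_boundedParams.1 x.2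
    exact hz _ _ _ h1 h2 h3 h4

theorem setOf_not_surjective_eq_iUnion (hp : 0 ≤ p) :
    {f : E ρ p | ¬ Surjective f} = ⋃ M : ℕ, range (expPolyMap ρ hp (M : ℝ)) := by
  ext f
  simp only [mem_iUnion, mem_range]
  constructor
  · intro hf
    obtain ⟨α, a, b, hα, hfα⟩ := exists_eq_expPoly hp f.2 hf
    obtain ⟨M, β, hβ, ha, hb, hβα⟩ := exists_bounded_expPoly ρ α a b
    have hβρ : ‖β ρ‖ ≤ p := by
      rwa [hβα ρ (Finset.mem_Icc.2 ⟨NeZero.one_le, le_rfl⟩)]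
    refine ⟨M, ⟨(β, a, b), mem_boundedParams.2 ⟨⟨hβ, ha, hb⟩, hβρ⟩⟩, ?_⟩
    refine Subtype.ext ?_
    rw [hfα]
    exact expPoly_congr hβα a b
  · rintro ⟨M, x, rfl⟩
    exact not_surjective_expPoly _ _ _ _

theorem isSigmaCompact_setOf_not_surjective (hp : 0 ≤ p) :
    IsSigmaCompact {f : E ρ p | ¬ Surjective f} := by
  rw [setOf_not_surjective_eq_iUnion hp]
  refine isSigmaCompact_iUnion_of_isCompact _ fun M => ?_
  have : CompactSpace (boundedParams ρ p M) :=
    isCompact_iff_compactSpace.1 (isCompact_boundedParams ρ p M)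
  exact isCompact_range (continuous_expPolyMap hp _)

theorem isGδ_setOf_surjective (hp : 0 ≤ p) : IsGδ {f : E ρ p | Surjective f} := by
  obtain ⟨K, hK, hKu⟩ := isSigmaCompact_setOf_not_surjective (ρ := ρ) hp
  have : {f : E ρ p | Surjective f} = ⋂ n, (K n)ᶜ := by
    rw [← compl_iUnion, hKu]
    ext f
    simp
  rw [this]
  exact IsGδ.iInter fun n => (hK n).isClosed.isOpen_compl.isGδ

/-! ### Density of the surjective functions -/

theorem pow_mem_entireSubmodule (hp : 0 < p) (k : ℕ) :
    (fun z : ℂ => z ^ k) ∈ entireSubmodule ρ p := by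
  refine ⟨by fun_prop, (growth_le_iff ρ p _).2 fun ε hε => ?_⟩
  have hlim : ∀ᶠ r : ℝ in atTop, ‖r ^ k‖ ≤ 1 * ‖Real.exp (p * r)‖ :=
    (isLittleO_pow_exp_pos_mul_atTop k hp).bound one_pos
  filter_upwards [tendsto_norm_cobounded_atTop.eventually hlim,
    tendsto_norm_cobounded_atTop.eventually_ge_atTop 1] with z h1 h2
  rw [Real.norm_of_nonneg (by positivity), Real.norm_of_nonneg (Real.exp_pos _).le, one_mul] at h1
  rw [norm_pow]
  refine h1.trans (Real.exp_le_exp.2 ?_)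
  have : ‖z‖ ≤ ‖z‖ ^ ρ := le_self_pow₀ h2 (NeZero.ne ρ)
  gcongr
  linarith

theorem sum_pow_mem_entireSubmodule (hp : 0 < p) (s : Finset ℕ) (c : ℕ → ℂ) :
    (fun z : ℂ => ∑ k ∈ s, c k * z ^ k) ∈ entireSubmodule ρ p := by
  have := (entireSubmodule ρ p).sum_mem (t := s) (f := fun k => c k • fun z : ℂ => z ^ k)
    fun k _ => (entireSubmodule ρ p).smul_mem (c k) (pow_mem_entireSubmodule hp k)
  convert this using 1
  ext z
  simp

/-- A nonconstant complex polynomial is surjective. -/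
theorem surjective_sum_pow {s : Finset ℕ} {c : ℕ → ℂ} {m : ℕ} (hm : m ∈ s) (hm0 : m ≠ 0)
    (hc : c m ≠ 0) : Surjective fun z : ℂ => ∑ k ∈ s, c k * z ^ k := by
  intro w
  let P : Polynomial ℂ := ∑ k ∈ s, Polynomial.C (c k) * Polynomial.X ^ k - Polynomial.C w
  have hcoeff : P.coeff m = c m := by
    simp [P, Polynomial.coeff_C, hm0, hm]
  have hdeg : P.degree ≠ 0 := by
    intro h
    have := Polynomial.coeff_eq_zero_of_degree_lt (p := P) (n := m)
      (by rw [h]; exact_mod_cast Nat.pos_of_ne_zero hm0)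
    exact hc (hcoeff ▸ this)
  obtain ⟨z, hz⟩ := IsAlgClosed.exists_root P hdeg
  refine ⟨z, ?_⟩
  simpa [P, Polynomial.eval_finsetSum, sub_eq_zero] using hz

/-- For `ε ≠ 0` the function `w ↦ exp w + ε w` is surjective: it lies in `E_{1,1}`, its derivative
has a zero and does not vanish identically. -/
theorem surjective_exp_add_mul {ε : ℂ} (hε : ε ≠ 0) :
    Surjective fun w : ℂ => Complex.exp w + ε * w := by
  by_contra hs
  have hmem : (fun w : ℂ => Complex.exp w + ε * w) ∈ entireSubmodule 1 1 := by
    have h1 := expPoly_mem 1 zero_le_one (α := 1) 0 1 (by simp)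
    have h2 := (entireSubmodule 1 1).smul_mem ε (pow_mem_entireSubmodule one_pos 1)
    convert (entireSubmodule 1 1).add_mem h1 h2 using 1
    ext w
    simp [expPoly]
  obtain ⟨α, a, b, -, h⟩ := exists_eq_expPoly zero_le_one hmem hs
  have hd : ∀ w, Complex.exp w + ε = b * (Complex.exp (α 1 * w) * α 1) := by
    intro w
    have h1 : HasDerivAt (fun w : ℂ => Complex.exp w + ε * w) (Complex.exp w + ε * 1) w :=
      (Complex.hasDerivAt_exp w).add ((hasDerivAt_id w).const_mul ε)
    have h2 : HasDerivAt (fun w : ℂ => b * Complex.exp (α 1 * w) + a)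
        (b * (Complex.exp (α 1 * w) * (α 1 * 1))) w :=
      ((((hasDerivAt_id w).const_mul (α 1)).cexp).const_mul b).add_const a
    have h3 : (fun w : ℂ => Complex.exp w + ε * w) = fun w => b * Complex.exp (α 1 * w) + a := by
      rw [h]; ext w; simp [expPoly]
    rw [h3] at h1
    simpa using h1.unique h2
  have h0 : b * α 1 = 0 := by
    -- At this point the derivative `exp w + ε` vanishes. The derivative of `b exp (α₁ w) + a` has a
    -- zero only if it is identically zero, which would make `exp` constant.
    have := hd (Complex.log (-ε))
    rw [Complex.exp_log (neg_ne_zero.2 hε), neg_add_cancel] at this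
    simpa [Complex.exp_ne_zero] using this.symm
  have hc : ∀ w, Complex.exp w = -ε := fun w => by
    have := hd w
    rw [mul_left_comm, h0, mul_zero] at this
    exact eq_neg_of_add_eq_zero_left this
  have hπ := (hc 0).trans (hc (Real.pi * Complex.I)).symm
  rw [Complex.exp_zero, Complex.exp_pi_mul_I] at hπ
  norm_num at hπ

/-- If `f + ε h` is surjective for all `ε ≠ 0`, then `f` is a limit of surjective functions. -/
theorem mem_closure_of_forall_surjective_add {f h : E ρ p}
    (hs : ∀ ε : ℂ, ε ≠ 0 → Surjective fun z => f z + ε * h z) :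
    f ∈ closure {f : E ρ p | Surjective f} := by
  have hcont : Continuous fun ε : ℂ => f + ε • h := by fun_prop
  have hlim : Tendsto (fun ε : ℂ => f + ε • h) (𝓝[≠] 0) (𝓝 f) := by
    have := hcont.tendsto 0
    rw [zero_smul, add_zero] at this
    exact this.mono_left nhdsWithin_le_nhds
  refine mem_closure_of_tendsto hlim ?_
  filter_upwards [self_mem_nhdsWithin] with ε hε
  exact hs ε hε

theorem dense_setOf_surjective (hp : 0 < p) : Dense {f : E ρ p | Surjective f} := by
  intro f
  by_cases hf : Surjective f
  · exact subset_closure hf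
  obtain ⟨α, a, b, -, hfα⟩ := exists_eq_expPoly hp.le f.2 hf
  have hf' : ∀ z, f z = expPoly ρ α a b z := fun z => congrFun hfα z
  by_cases hb : b ≠ 0 ∧ ∃ m ∈ Finset.Icc 1 ρ, α m ≠ 0
  · obtain ⟨hb, m, hm, hαm⟩ := hb
    refine mem_closure_of_forall_surjective_add
      (h := b • E.mk _ (sum_pow_mem_entireSubmodule hp (Finset.Icc 1 ρ) α)) fun ε hε w => ?_
    -- With `P = ∑ α_k z^k`, the perturbed function is `a + b (exp P + ε P)`: first solve for the
    -- value `v` of `P`, then for `z`.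
    obtain ⟨v, hv⟩ := surjective_exp_add_mul hε ((w - a) / b)
    obtain ⟨z, hz⟩ := surjective_sum_pow hm (Nat.one_le_iff_ne_zero.1 (Finset.mem_Icc.1 hm).1) hαm v
    refine ⟨z, ?_⟩
    dsimp only at hz hv ⊢
    rw [hf', E.smul_apply, E.mk_apply, expPoly, hz]
    linear_combination b * hv + mul_div_cancel₀ (w - a) hb
  -- If `b = 0` or all the `α_k` vanish, `f` is constant and `f + ε z` is an affine bijection.
  · have hconst : ∃ d, ∀ z, f z = d := by
      push Not at hb
      by_cases hb0 : b = 0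
      · exact ⟨a, fun z => by simp [hf', expPoly, hb0]⟩
      · refine ⟨b + a, fun z => ?_⟩
        rw [hf', expPoly, Finset.sum_eq_zero fun k hk => by rw [hb hb0 k hk, zero_mul]]
        simp
    obtain ⟨d, hd⟩ := hconst
    refine mem_closure_of_forall_surjective_add
      (h := E.mk _ (pow_mem_entireSubmodule hp 1)) fun ε hε w => ?_
    refine ⟨(w - d) / ε, ?_⟩
    dsimp only
    rw [hd, E.mk_apply, pow_one]
    field_simp
    ring

theorem image_setOf_not_surjective (hp : 0 ≤ p) :
    (fun (f : E ρ p) (z : ℂ) => f z) '' {f : E ρ p | ¬ Surjective f} =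
      {g : ℂ → ℂ | ∃ (α : ℕ → ℂ) (a b : ℂ), ‖α ρ‖ ≤ p ∧ g = expPoly ρ α a b} := by
  ext g
  constructor
  · rintro ⟨f, hf, rfl⟩
    exact exists_eq_expPoly hp f.2 hf
  · rintro ⟨α, a, b, hα, rfl⟩
    exact ⟨E.mk _ (expPoly_mem ρ hp a b hα), not_surjective_expPoly ρ α a b, rfl⟩

end EntireGrowth

theorem mainTheorem8 (ρ : ℕ) [NeZero ρ] (p : ℝ) (hp : 0 < p) :
    IsGδ {f : EntireGrowth.E ρ p | Function.Surjective f} ∧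
    Dense {f : EntireGrowth.E ρ p | Function.Surjective f} ∧
    (fun (f : EntireGrowth.E ρ p) (z : ℂ) => f z) ''
        {f : EntireGrowth.E ρ p | ¬ Function.Surjective f} =
      {g : ℂ → ℂ | ∃ (α : ℕ → ℂ) (a b : ℂ), ‖α ρ‖ ≤ p ∧ g = EntireGrowth.expPoly ρ α a b} ∧
    IsSigmaCompact {f : EntireGrowth.E ρ p | ¬ Function.Surjective f} := by
  exact ⟨EntireGrowth.isGδ_setOf_surjective hp.le, EntireGrowth.dense_setOf_surjective hp,
    EntireGrowth.image_setOf_not_surjective hp.le,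
    EntireGrowth.isSigmaCompact_setOf_not_surjective hp.le⟩
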